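/- A Kleene algebra is an algebra $(A,\wedge,\vee,\neg,0,1)$ such that $(A,\wedge,\vee,0,1)$ is a bounded distributive lattice and $x=\neg\neg x$, $x\wedge y=\neg(\neg x\vee\neg y)$ and $x\wedge\neg x\le y\vee\neg y$ hold for all $x,y\in A$; let $\mathsf{KA}$ be the variety of Kleene algebras. An algebra $P$ in a variety $\mathsf V$ is *projective* in $\mathsf V$ if for all $A,B\in\mathsf V$, every homomorphism $h:P\to B$ and every surjective homomorphism $g:A\to B$ there is a homomorphism $f:P\to A$ with $g\circ f=h$. It is *exact* in $\mathsf V$ if it is isomorphic to a finitely generated subalgebra of a finitely generated free algebra of $\mathsf V$. An algebra $S\in\mathsf V$ is *strongly projective* in $\mathsf V$ if it is projective in $\mathsf V$ and for every embedding $i:S\to P$ into a projective algebra $P$ of $\mathsf V$ there is a homomorphism $j:P\to S$ with $j\circ i=\mathrm{id}_S$. The variety $\mathsf V$ has the *1ESP property* if every 1-generated exact algebra in $\mathsf V$ is strongly projective in $\mathsf V$. **Theorem.** The variety $\mathsf{KA}$ has the 1ESP property. More precisely, an algebra in the signature of Kleene algebras is a 1-generated exact Kleene algebra if and only if it is isomorphic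 to one of the following three pairwise non-isomorphic Kleene algebras, each of which is strongly projective in $\mathsf{KA}$: the free Kleene algebra on one generator, the 4-element chain $\mathbf K_4$, and the 2-element chain $\mathbf 2$, where a finite chain carries its unique order-reversing involution as $\neg$. -/

import Mathlib

open FirstOrder FirstOrder.Language

universe u w

/-! ## Varieties of algebras, free algebras, projective and exact algebras

An algebraic signature is a first-order language `L` without relation symbols, an algebra is an
`L`-structure, homomorphisms are `A →[L] B`, isomorphisms are `A ≃[L] B`, subalgebras are
`L.Substructure A`, and terms over a set `X` of variables are elements of `L.Term X`. -/

namespace UnivAlg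

/-- A set of equations `s ≈ t` between terms in countably many variables. The variety that it
defines is the class of all its models. -/
abbrev Equations (L : FirstOrder.Language.{0, 0}) : Type := Set (L.Term ℕ × L.Term ℕ)

variable {L : FirstOrder.Language.{0, 0}}

/-- The algebra `A` belongs to the variety defined by `E`. -/
def InVariety (E : Equations L) (A : Type u) [L.Structure A] : Prop :=
  ∀ e ∈ E, ∀ v : ℕ → A, e.1.realize v = e.2.realize v

/-- The least congruence of the term algebra over `X` that contains all substitution instances of
the equations in `E`. -/
inductive EqCong (E : Equations L) (X : Type w) : L.Term X → L.Term X → Prop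
  | refl (t : L.Term X) : EqCong E X t t
  | symm {s t : L.Term X} : EqCong E X s t → EqCong E X t s
  | trans {s t r : L.Term X} : EqCong E X s t → EqCong E X t r → EqCong E X s r
  | func {n : ℕ} (f : L.Functions n) (ts ss : Fin n → L.Term X) :
      (∀ i, EqCong E X (ts i) (ss i)) → EqCong E X (Term.func f ts) (Term.func f ss)
  | ax (e : L.Term ℕ × L.Term ℕ) (he : e ∈ E) (σ : ℕ → L.Term X) :
      EqCong E X (e.1.subst σ) (e.2.subst σ)

/-- `EqCong` as a setoid. -/
def eqSetoid (E : Equations L) (X : Type w) : Setoid (L.Term X) where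
  r := EqCong E X
  iseqv := ⟨EqCong.refl, EqCong.symm, EqCong.trans⟩

/-- The free algebra over `X` in the variety defined by `E`: terms over `X` modulo `E`. -/
def FreeAlg (E : Equations L) (X : Type w) : Type w := Quotient (eqSetoid E X)

/-- The operations of the term algebra are compatible with the congruence. -/
instance eqPrestructure [L.IsAlgebraic] (E : Equations L) (X : Type w) :
    L.Prestructure (eqSetoid E X) where
  toStructure :=
    { funMap := fun f ts => Term.func f ts
      RelMap := fun r _ => isEmptyElim r }
  fun_equiv := fun {_ f} ts ss h => EqCong.func f ts ss h
  rel_equiv := fun {_ r} _ _ _ => isEmptyElim r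

instance [L.IsAlgebraic] (E : Equations L) (X : Type w) : L.Structure (FreeAlg E X) :=
  quotientStructure (s := eqSetoid E X)

/-- `P` is projective in the variety defined by `E`. -/
def IsProjective (E : Equations L) (P : Type u) [L.Structure P] : Prop :=
  InVariety E P ∧
    ∀ (A B : Type u) [L.Structure A] [L.Structure B], InVariety E A → InVariety E B →
      ∀ (h : P →[L] B) (g : A →[L] B), Function.Surjective g →
        ∃ f : P →[L] A, g.comp f = h

/-- `A` is exact in the variety defined by `E`: it is isomorphic to a finitely generated subalgebra
of a finitely generated free algebra. -/
def IsExact [L.IsAlgebraic] (E : Equations L) (A : Type u) [L.Structure A] : Prop :=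
  InVariety E A ∧
    ∃ (n : ℕ) (S : L.Substructure (FreeAlg E (Fin n))), S.FG ∧ Nonempty (A ≃[L] S)

/-- `A` is generated by a single element. -/
def IsOneGenerated (L : FirstOrder.Language.{0, 0}) (A : Type u) [L.Structure A] : Prop :=
  ∃ a : A, Substructure.closure L {a} = ⊤

/-- `S` is strongly projective in the variety defined by `E`: it is projective, and each embedding
of it into a projective algebra splits. -/
def IsStronglyProjective (E : Equations L) (S : Type u) [L.Structure S] : Prop :=
  IsProjective E S ∧
    ∀ (P : Type u) [L.Structure P], IsProjective E P →
      ∀ i : S →[L] P, Function.Injective i → ∃ j : P →[L] S, j.comp i = Hom.id L S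

/-- The variety defined by `E` is 1ESP: each of its 1-generated exact algebras is strongly
projective in it. -/
def OneESP [L.IsAlgebraic] (E : Equations L) : Prop :=
  ∀ (A : Type u) [L.Structure A], IsOneGenerated L A → IsExact E A → IsStronglyProjective E A

end UnivAlg

/-! ## Kleene algebras -/

namespace Kleene

/-- The operation symbols of Kleene algebras. -/
inductive Op : ℕ → Type
  | bot : Op 0
  | top : Op 0
  | neg : Op 1
  | inf : Op 2
  | sup : Op 2

/-- The signature `∧, ∨, ¬, 0, 1`. -/
def lang : FirstOrder.Language.{0, 0} := ⟨Op, fun _ => Empty⟩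

instance : lang.IsAlgebraic := fun _ => inferInstanceAs (IsEmpty Empty)

/-- The term `0`. -/
def zero : lang.Term ℕ := Constants.term (L := lang) Op.bot

/-- The term `1`. -/
def one : lang.Term ℕ := Constants.term (L := lang) Op.top

/-- The term `¬ s`. -/
def neg (s : lang.Term ℕ) : lang.Term ℕ := Functions.apply₁ (L := lang) Op.neg s

/-- The term `s ∧ t`. -/
def inf (s t : lang.Term ℕ) : lang.Term ℕ := Functions.apply₂ (L := lang) Op.inf s t

/-- The term `s ∨ t`. -/
def sup (s t : lang.Term ℕ) : lang.Term ℕ := Functions.apply₂ (L := lang) Op.sup s t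

/-- The variable `x`. -/
def x : lang.Term ℕ := Term.var 0

/-- The variable `y`. -/
def y : lang.Term ℕ := Term.var 1

/-- The variable `z`. -/
def z : lang.Term ℕ := Term.var 2

/-- The equations of Kleene algebras: bounded distributive lattices with an involution `¬` that
satisfies the De Morgan identity and the Kleene identity `x ∧ ¬x ≤ y ∨ ¬y`. -/
def KA : UnivAlg.Equations lang :=
  { (inf x y, inf y x),
    (sup x y, sup y x),
    (inf (inf x y) z, inf x (inf y z)),
    (sup (sup x y) z, sup x (sup y z)),
    (inf x (sup x y), x),
    (sup x (inf x y), x),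
    (inf x (sup y z), sup (inf x y) (inf x z)),
    (sup x zero, x),
    (inf x one, x),
    (x, neg (neg x)),
    (inf x y, neg (sup (neg x) (neg y))),
    (inf (inf x (neg x)) (sup y (neg y)), inf x (neg x)) }

/-- The carrier of the chain with `n` elements. -/
abbrev Chain (n : ℕ) : Type := Fin n

/-- The chain `0 < 1 < ⋯ < n - 1` with the order-reversing involution `k ↦ n - 1 - k`. -/
instance (n : ℕ) [NeZero n] : lang.Structure (Chain n) where
  funMap := fun {_} f =>
    match f with
    | Op.bot => fun _ => 0
    | Op.top => fun _ => Fin.rev 0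
    | Op.neg => fun a => Fin.rev (a 0)
    | Op.inf => fun a => min (a 0) (a 1)
    | Op.sup => fun a => max (a 0) (a 1)
  RelMap := fun r _ => isEmptyElim r

end Kleene

/-! A 1-generated exact algebra is generated by some `a` and embeds into a free algebra; let `t` be
the image of `a`. Everything depends on how `t` compares with `¬t`. If `t` is `0` or `1`, the
algebra is the 2-element chain. If `t ≤ ¬t` and `t ≠ 0`, the chain `0, t, ¬t, 1` is a copy of the
4-element chain; `¬t ≤ t` is the same case with `¬a` as generator. If `t` and `¬t` are incomparable,
the algebra is free on `a`.

In each case a homomorphism from the ambient free algebra sends `t` to the standard generator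
(`exists_retraction_chain_four`, `exists_retraction_free`). It proves injectivity in the
classification and also splits embeddings into free algebras. Splitting those is enough for strong
projectivity, because a projective algebra is a retract of a free one.

The retractions are built from valuations in the 3-element chain, which come from prime filters
(`exists_hom_ne_zero`, `exists_hom_eq_two`). Freeness allows such valuations to be modified on the
variables. -/

namespace UnivAlg

-- Free algebras, retracts and exactness in an arbitrary variety

universe v

variable {L : FirstOrder.Language.{0, 0}} {E : Equations L} {A : Type u} {B : Type v}
  [L.Structure A] [L.Structure B]

theorem InVariety.of_injective (hB : InVariety E B) (f : A →[L] B) (hf : Function.Injective f) :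
    InVariety E A := fun e he v => hf <| by
  rw [← HomClass.realize_term f, ← HomClass.realize_term f]
  exact hB e he _

theorem eq_of_eqCong {X : Type w} (hA : InVariety E A) (f : X → A) {s t : L.Term X}
    (h : EqCong E X s t) : s.realize f = t.realize f := by
  induction h with
  | refl t => rfl
  | symm _ ih => exact ih.symm
  | trans _ _ ih₁ ih₂ => exact ih₁.trans ih₂
  | func g ts ss _ ih => simp only [Term.realize, ih]
  | ax e he σ =>
    rw [Term.realize_subst, Term.realize_subst]
    exact hA e he _

/-- The range is a subalgebra, so it suffices that it contains the generator. -/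
theorem surjective_of_closure_singleton {a : A} (ha : Substructure.closure L {a} = ⊤)
    (f : B →[L] A) (h : ∃ b, f b = a) : Function.Surjective f := by
  rw [← Hom.range_eq_top, eq_top_iff, ← ha, Substructure.closure_le, Set.singleton_subset_iff]
  exact h

namespace FreeAlg

variable {X : Type w}

/-- The class of a term in the free algebra. -/
def mk (E : Equations L) (t : L.Term X) : FreeAlg E X := Quotient.mk (eqSetoid E X) t

/-- The free generators. -/
def var (E : Equations L) (i : X) : FreeAlg E X := mk E (Term.var i)

theorem exists_eq_mk {ι : Type*} (xs : ι → FreeAlg E X) :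
    ∃ ts : ι → L.Term X, xs = fun i => mk E (ts i) :=
  ⟨fun i => Quotient.out (s := eqSetoid E X) (xs i),
    funext fun i => (Quotient.out_eq (s := eqSetoid E X) (xs i)).symm⟩

end FreeAlg

section IsAlgebraic

variable [L.IsAlgebraic]

namespace FreeAlg

variable {X : Type w}

theorem funMap_mk {n : ℕ} (f : L.Functions n) (ts : Fin n → L.Term X) :
    (Structure.funMap f fun i => mk E (ts i)) = mk E (Term.func f ts) :=
  funMap_quotient_mk' (eqSetoid E X) f ts

theorem realize_mk (t : L.Term ℕ) (σ : ℕ → L.Term X) :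
    t.realize (fun n => mk E (σ n)) = mk E (t.subst σ) := by
  induction t with
  | var => rfl
  | func f ts ih => simp only [Term.realize, ih, funMap_mk, Term.subst]

theorem inVariety (E : Equations L) (X : Type w) : InVariety E (FreeAlg E X) := by
  intro e he v
  obtain ⟨σ, rfl⟩ := exists_eq_mk v
  rw [realize_mk, realize_mk]
  exact Quotient.sound (EqCong.ax e he _)

/-- The underlying map of `FreeAlg.lift`. -/
def eval (hA : InVariety E A) (f : X → A) : FreeAlg E X → A :=
  Quotient.lift (fun t => t.realize f) fun _ _ h => eq_of_eqCong hA f h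

/-- The homomorphism that extends an assignment of the generators. -/
def lift (hA : InVariety E A) (f : X → A) : FreeAlg E X →[L] A where
  toFun := eval hA f
  map_fun' := by
    intro n g xs
    obtain ⟨ts, rfl⟩ := exists_eq_mk xs
    rw [funMap_mk]
    rfl
  map_rel' := fun r _ => isEmptyElim r

@[simp]
theorem lift_var (hA : InVariety E A) (f : X → A) (i : X) : lift hA f (var E i) = f i := rfl

theorem closure_range_var (E : Equations L) (X : Type w) :
    Substructure.closure L (Set.range (var E : X → FreeAlg E X)) = ⊤ := by
  rw [eq_top_iff]
  rintro a -
  induction a using Quotient.ind with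
  | _ t =>
    induction t with
    | var i => exact Substructure.subset_closure ⟨i, rfl⟩
    | func f ts ih =>
      change mk E (Term.func f ts) ∈ _
      rw [← funMap_mk]
      exact Substructure.fun_mem _ f _ ih

theorem hom_ext {f g : FreeAlg E X →[L] A} (h : ∀ i, f (var E i) = g (var E i)) : f = g :=
  Hom.eq_of_eqOn_dense (closure_range_var E X) (by rintro _ ⟨i, rfl⟩; exact h i)

end FreeAlg

/-- A retract of a free algebra is projective. -/
theorem IsProjective.of_retract {X : Type w} (s : A →[L] FreeAlg E X) (r : FreeAlg E X →[L] A)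
    (hrs : ∀ a, r (s a) = a) : IsProjective E A := by
  refine ⟨(FreeAlg.inVariety E X).of_injective s (Function.LeftInverse.injective hrs), ?_⟩
  intro B C _ _ hB hC h g hg
  choose c hc using hg
  let f := FreeAlg.lift hB fun i => c (h (r (FreeAlg.var E i)))
  have hf : g.comp f = h.comp r := FreeAlg.hom_ext fun i => by
    simp [f, Hom.comp_apply, hc]
  refine ⟨f.comp s, Hom.ext fun a => ?_⟩
  have := DFunLike.congr_fun hf (s a)
  simpa [Hom.comp_apply, hrs] using this

/-- A projective algebra is a retract of the free algebra over its carrier. -/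
theorem IsProjective.exists_section (hA : IsProjective E A) :
    ∃ s : A →[L] FreeAlg E A, ∀ a, FreeAlg.lift hA.1 id (s a) = a := by
  obtain ⟨s, hs⟩ := hA.2 _ _ (FreeAlg.inVariety E A) hA.1 (Hom.id L A)
    (FreeAlg.lift hA.1 id) fun a => ⟨FreeAlg.var E a, rfl⟩
  exact ⟨s, fun a => DFunLike.congr_fun hs a⟩

/-- A retract of a free algebra that is a retract of each free algebra into which it embeds is
strongly projective. -/
theorem IsStronglyProjective.of_retract {X : Type w} (s : A →[L] FreeAlg E X)
    (r : FreeAlg E X →[L] A) (hrs : ∀ a, r (s a) = a)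
    (h : ∀ (Y : Type u) (i : A →[L] FreeAlg E Y), Function.Injective i →
      ∃ j : FreeAlg E Y →[L] A, ∀ a, j (i a) = a) : IsStronglyProjective E A := by
  refine ⟨IsProjective.of_retract s r hrs, fun P _ hP i hi => ?_⟩
  obtain ⟨t, ht⟩ := hP.exists_section
  obtain ⟨j, hj⟩ := h P (t.comp i) ((Function.LeftInverse.injective ht).comp hi)
  exact ⟨j.comp t, Hom.ext hj⟩

/-- Membership in the variety and finite generation of the image come for free, so only the
generator and the embedding remain. -/
theorem isOneGenerated_exact_iff :
    (IsOneGenerated L A ∧ IsExact E A) ↔ ∃ a : A, Substructure.closure L {a} = ⊤ ∧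
      ∃ (n : ℕ) (i : A →[L] FreeAlg E (Fin n)), Function.Injective i := by
  constructor
  · rintro ⟨⟨a, ha⟩, -, n, S, -, ⟨e⟩⟩
    exact ⟨a, ha, n, S.subtype.toHom.comp e.toHom, S.subtype.injective.comp e.injective⟩
  · rintro ⟨a, ha, n, i, hi⟩
    refine ⟨⟨a, ha⟩, (FreeAlg.inVariety E _).of_injective i hi, n, i.range, ?_, ⟨?_⟩⟩
    · rw [Hom.range_eq_map, ← ha]
      exact (Substructure.fg_closure_singleton a).map i
    · exact
        { toEquiv := _root_.Equiv.ofInjective i hi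
          map_fun' := fun f x => Subtype.ext (i.map_fun f x)
          map_rel' := fun r _ => isEmptyElim r }

theorem isOneGenerated_exact_congr (e : A ≃[L] B) (h : IsOneGenerated L B ∧ IsExact E B) :
    IsOneGenerated L A ∧ IsExact E A := by
  rw [isOneGenerated_exact_iff] at h ⊢
  obtain ⟨b, hb, n, i, hi⟩ := h
  refine ⟨e.symm b, ?_, n, i.comp e.toHom, hi.comp e.injective⟩
  have := Substructure.closure_image (L := L) (s := {b}) e.symm.toHom
  rw [hb, ← Hom.range_eq_map, Set.image_singleton] at this
  refine this.trans ?_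
  exact Hom.range_eq_top.2 e.symm.surjective

/-- Bijective homomorphisms of algebras are isomorphisms. -/
noncomputable def equivOfBijective (f : A →[L] B) (hf : Function.Bijective f) : A ≃[L] B where
  toEquiv := _root_.Equiv.ofBijective f hf
  map_fun' := f.map_fun
  map_rel' := fun r _ => isEmptyElim r

end IsAlgebraic

end UnivAlg

namespace Kleene

universe v

open UnivAlg

/-! ### The five operations and the equations of Kleene algebras -/

section Operations

variable {A : Type u} {B : Type v} [lang.Structure A] [lang.Structure B]

/-- The constant `0` of an algebra. -/
def opBot (A : Type u) [lang.Structure A] : A := Structure.funMap (L := lang) Op.bot ![]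

/-- The constant `1` of an algebra. -/
def opTop (A : Type u) [lang.Structure A] : A := Structure.funMap (L := lang) Op.top ![]

/-- The negation of an algebra. -/
def opNeg (a : A) : A := Structure.funMap (L := lang) Op.neg ![a]

/-- The meet of an algebra. -/
def opInf (a b : A) : A := Structure.funMap (L := lang) Op.inf ![a, b]

/-- The join of an algebra. -/
def opSup (a b : A) : A := Structure.funMap (L := lang) Op.sup ![a, b]

theorem funMap_bot (xs : Fin 0 → A) : Structure.funMap (L := lang) Op.bot xs = opBot A :=
  congrArg _ (Subsingleton.elim _ _)

theorem funMap_top (xs : Fin 0 → A) : Structure.funMap (L := lang) Op.top xs = opTop A :=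
  congrArg _ (Subsingleton.elim _ _)

theorem funMap_neg (xs : Fin 1 → A) : Structure.funMap (L := lang) Op.neg xs = opNeg (xs 0) :=
  congrArg _ (List.ofFn_inj.1 rfl)

theorem funMap_inf (xs : Fin 2 → A) :
    Structure.funMap (L := lang) Op.inf xs = opInf (xs 0) (xs 1) :=
  congrArg _ (List.ofFn_inj.1 rfl)

theorem funMap_sup (xs : Fin 2 → A) :
    Structure.funMap (L := lang) Op.sup xs = opSup (xs 0) (xs 1) :=
  congrArg _ (List.ofFn_inj.1 rfl)

section Hom

variable (f : A →[lang] B)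

@[simp]
theorem map_opBot : f (opBot A) = opBot B := (f.map_fun _ _).trans (funMap_bot _)

@[simp]
theorem map_opTop : f (opTop A) = opTop B := (f.map_fun _ _).trans (funMap_top _)

@[simp]
theorem map_opNeg (a : A) : f (opNeg a) = opNeg (f a) := (f.map_fun _ _).trans (funMap_neg _)

@[simp]
theorem map_opInf (a b : A) : f (opInf a b) = opInf (f a) (f b) :=
  (f.map_fun _ _).trans (funMap_inf _)

@[simp]
theorem map_opSup (a b : A) : f (opSup a b) = opSup (f a) (f b) :=
  (f.map_fun _ _).trans (funMap_sup _)

end Hom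

/-- A map that respects the five operations is a homomorphism. -/
def mkHom (f : A → B) (hbot : f (opBot A) = opBot B) (htop : f (opTop A) = opTop B)
    (hneg : ∀ a, f (opNeg a) = opNeg (f a)) (hinf : ∀ a b, f (opInf a b) = opInf (f a) (f b))
    (hsup : ∀ a b, f (opSup a b) = opSup (f a) (f b)) : A →[lang] B where
  toFun := f
  map_fun' := by
    rintro n (_ | _ | _ | _ | _) xs
    · exact (congrArg f (funMap_bot xs)).trans (hbot.trans (funMap_bot _).symm)
    · exact (congrArg f (funMap_top xs)).trans (htop.trans (funMap_top _).symm)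
    · exact (congrArg f (funMap_neg xs)).trans ((hneg _).trans (funMap_neg (f ∘ xs)).symm)
    · exact (congrArg f (funMap_inf xs)).trans ((hinf _ _).trans (funMap_inf (f ∘ xs)).symm)
    · exact (congrArg f (funMap_sup xs)).trans ((hsup _ _).trans (funMap_sup (f ∘ xs)).symm)
  map_rel' := fun r _ => isEmptyElim r

theorem op_closure_induction {p : A → Prop} {s : Set A} (hs : ∀ a ∈ s, p a) (hbot : p (opBot A))
    (htop : p (opTop A)) (hneg : ∀ a, p a → p (opNeg a))
    (hinf : ∀ a b, p a → p b → p (opInf a b)) (hsup : ∀ a b, p a → p b → p (opSup a b))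
    {a : A} (ha : a ∈ Substructure.closure lang s) : p a := by
  refine Substructure.closure_induction ha hs ?_
  rintro n (_ | _ | _ | _ | _) xs hxs
  · exact (funMap_bot xs).symm ▸ hbot
  · exact (funMap_top xs).symm ▸ htop
  · exact (funMap_neg xs).symm ▸ hneg _ (hxs 0)
  · exact (funMap_inf xs).symm ▸ hinf _ _ (hxs 0) (hxs 1)
  · exact (funMap_sup xs).symm ▸ hsup _ _ (hxs 0) (hxs 1)

theorem freeAlg_induction {X : Type w} {p : FreeAlg KA X → Prop}
    (hvar : ∀ i, p (FreeAlg.var KA i)) (hbot : p (opBot _))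
    (htop : p (opTop _)) (hneg : ∀ a, p a → p (opNeg a))
    (hinf : ∀ a b, p a → p b → p (opInf a b)) (hsup : ∀ a b, p a → p b → p (opSup a b))
    (a : FreeAlg KA X) : p a :=
  op_closure_induction (s := Set.range (FreeAlg.var KA)) (by rintro _ ⟨i, rfl⟩; exact hvar i)
    hbot htop hneg hinf hsup (by rw [FreeAlg.closure_range_var]; trivial)

section Realize

variable (v : ℕ → A) (s t : lang.Term ℕ)

theorem realize_zero : zero.realize v = opBot A := funMap_bot _

theorem realize_one : one.realize v = opTop A := funMap_top _

theorem realize_neg : (neg s).realize v = opNeg (s.realize v) := funMap_neg _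

theorem realize_inf : (inf s t).realize v = opInf (s.realize v) (t.realize v) := funMap_inf _

theorem realize_sup : (sup s t).realize v = opSup (s.realize v) (t.realize v) := funMap_sup _

end Realize

theorem inVariety_iff : InVariety KA A ↔ ∀ a b c : A,
    opInf a b = opInf b a ∧ opSup a b = opSup b a ∧
    opInf (opInf a b) c = opInf a (opInf b c) ∧ opSup (opSup a b) c = opSup a (opSup b c) ∧
    opInf a (opSup a b) = a ∧ opSup a (opInf a b) = a ∧
    opInf a (opSup b c) = opSup (opInf a b) (opInf a c) ∧
    opSup a (opBot A) = a ∧ opInf a (opTop A) = a ∧ a = opNeg (opNeg a) ∧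
    opInf a b = opNeg (opSup (opNeg a) (opNeg b)) ∧
    opInf (opInf a (opNeg a)) (opSup b (opNeg b)) = opInf a (opNeg a) := by
  have hx (v : ℕ → A) : x.realize v = v 0 := rfl
  have hy (v : ℕ → A) : y.realize v = v 1 := rfl
  have hz (v : ℕ → A) : z.realize v = v 2 := rfl
  simp only [InVariety, KA, Set.mem_insert_iff, Set.mem_singleton_iff, forall_eq_or_imp, forall_eq,
    realize_zero, realize_one, realize_neg, realize_inf, realize_sup, hx, hy, hz]
  constructor
  · rintro ⟨h1, h2, h3, h4, h5, h6, h7, h8, h9, h10, h11, h12⟩ a b c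
    -- Only the first three variables occur in the equations, so the value at the others is
    -- arbitrary.
    let v : ℕ → A := fun n => if n = 0 then a else if n = 1 then b else c
    exact ⟨h1 v, h2 v, h3 v, h4 v, h5 v, h6 v, h7 v, h8 v, h9 v, h10 v, h11 v, h12 v⟩
  · intro h
    refine ⟨?_, ?_, ?_, ?_, ?_, ?_, ?_, ?_, ?_, ?_, ?_, ?_⟩ <;> intro v <;>
      obtain ⟨h1, h2, h3, h4, h5, h6, h7, h8, h9, h10, h11, h12⟩ := h (v 0) (v 1) (v 2) <;>
      assumption

end Operations

theorem inVariety_chain_two : InVariety KA (Chain 2) := inVariety_iff.2 (by decide)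

theorem inVariety_chain_three : InVariety KA (Chain 3) := inVariety_iff.2 (by decide)

theorem inVariety_chain_four : InVariety KA (Chain 4) := inVariety_iff.2 (by decide)

/-! ### The lattice order and the six elements of a 1-generated algebra -/

section Lattice

variable {A : Type u} [lang.Structure A]

/-- The lattice order of a Kleene algebra. -/
abbrev toDistribLattice (hA : InVariety KA A) : DistribLattice A :=
  letI : Max A := ⟨opSup⟩
  letI : Min A := ⟨opInf⟩
  have h := inVariety_iff.1 hA
  letI : Lattice A := Lattice.mk' (fun a b => (h a b a).2.1)
    (fun a b c => (h a b c).2.2.2.1) (fun a b => (h a b a).1) (fun a b c => (h a b c).2.2.1)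
    (fun a b => (h a b a).2.2.2.2.2.1) (fun a b => (h a b a).2.2.2.2.1)
  DistribLattice.ofInfSupLe fun a b c => ((h a b c).2.2.2.2.2.2.1).le

/-- The bounds of a Kleene algebra. -/
abbrev toBoundedOrder (hA : InVariety KA A) :
    letI := toDistribLattice hA
    BoundedOrder A :=
  letI := toDistribLattice hA
  have h := inVariety_iff.1 hA
  { bot := opBot A
    top := opTop A
    bot_le := fun a => sup_eq_left.1 (h a a a).2.2.2.2.2.2.2.1
    le_top := fun a => inf_eq_left.1 (h a a a).2.2.2.2.2.2.2.2.1 }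

end Lattice

/-- The lattice order depends on a proof of the equations; `Fact` lets instance search supply it for
free algebras. -/
instance (X : Type w) : Fact (InVariety KA (FreeAlg KA X)) := ⟨FreeAlg.inVariety KA X⟩

section KleeneLattice

variable {A : Type u} [lang.Structure A] [hA : Fact (InVariety KA A)]

local instance instDistribLattice : DistribLattice A := toDistribLattice hA.out

local instance instBoundedOrder : BoundedOrder A := toBoundedOrder hA.out

theorem opInf_eq (a b : A) : opInf a b = a ⊓ b := rfl

theorem opSup_eq (a b : A) : opSup a b = a ⊔ b := rfl

theorem opBot_eq : opBot A = ⊥ := rfl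

theorem opTop_eq : opTop A = ⊤ := rfl

@[simp]
theorem opNeg_opNeg (a : A) : opNeg (opNeg a) = a :=
  ((inVariety_iff.1 hA.out a a a).2.2.2.2.2.2.2.2.2.1).symm

theorem opNeg_sup (a b : A) : opNeg (a ⊔ b) = opNeg a ⊓ opNeg b := by
  have := ((inVariety_iff.1 hA.out (opNeg a) (opNeg b) a).2.2.2.2.2.2.2.2.2.2.1).symm
  rw [opNeg_opNeg, opNeg_opNeg] at this
  exact this

theorem opNeg_inf (a b : A) : opNeg (a ⊓ b) = opNeg a ⊔ opNeg b := by
  rw [← opNeg_opNeg (opNeg a ⊔ opNeg b), opNeg_sup, opNeg_opNeg, opNeg_opNeg]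

theorem inf_opNeg_le (a b : A) : a ⊓ opNeg a ≤ b ⊔ opNeg b :=
  inf_eq_left.1 (inVariety_iff.1 hA.out a b a).2.2.2.2.2.2.2.2.2.2.2

theorem opNeg_anti {a b : A} (h : a ≤ b) : opNeg b ≤ opNeg a := by
  rw [← sup_eq_right.2 h, opNeg_sup]
  exact inf_le_left

theorem opNeg_bot : opNeg (⊥ : A) = ⊤ := by
  rw [eq_top_iff, ← opNeg_opNeg (⊤ : A)]
  exact opNeg_anti bot_le

theorem opNeg_top : opNeg (⊤ : A) = ⊥ := by rw [← opNeg_bot, opNeg_opNeg]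

/-- The subalgebra generated by `a` consists of six elements. -/
theorem mem_closure_singleton {a b : A} (hb : b ∈ Substructure.closure lang {a}) :
    b = ⊥ ∨ b = ⊤ ∨ b = a ∨ b = opNeg a ∨ b = a ⊓ opNeg a ∨ b = a ⊔ opNeg a := by
  have hneg : ∀ b : A, (b = ⊥ ∨ b = ⊤ ∨ b = a ∨ b = opNeg a ∨ b = a ⊓ opNeg a ∨
      b = a ⊔ opNeg a) → (opNeg b = ⊥ ∨ opNeg b = ⊤ ∨ opNeg b = a ∨ opNeg b = opNeg a ∨
      opNeg b = a ⊓ opNeg a ∨ opNeg b = a ⊔ opNeg a) := by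
    rintro b (rfl | rfl | rfl | rfl | rfl | rfl) <;>
      simp [opNeg_bot, opNeg_top, opNeg_inf, opNeg_sup, sup_comm, inf_comm]
  have hinf : ∀ b c : A, (b = ⊥ ∨ b = ⊤ ∨ b = a ∨ b = opNeg a ∨ b = a ⊓ opNeg a ∨
      b = a ⊔ opNeg a) → (c = ⊥ ∨ c = ⊤ ∨ c = a ∨ c = opNeg a ∨ c = a ⊓ opNeg a ∨
      c = a ⊔ opNeg a) → (b ⊓ c = ⊥ ∨ b ⊓ c = ⊤ ∨ b ⊓ c = a ∨ b ⊓ c = opNeg a ∨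
      b ⊓ c = a ⊓ opNeg a ∨ b ⊓ c = a ⊔ opNeg a) := by
    have h1 : a ⊓ opNeg a ≤ a ⊔ opNeg a := inf_opNeg_le a a
    have h6 : opNeg a ⊓ a = a ⊓ opNeg a := inf_comm _ _
    rintro b c (rfl | rfl | rfl | rfl | rfl | rfl) (rfl | rfl | rfl | rfl | rfl | rfl) <;>
      simp [h1, h6]
  refine op_closure_induction (s := {a}) ?_ (Or.inl rfl) (Or.inr (Or.inl rfl)) hneg hinf ?_ hb
  · rintro b rfl
    simp
  · intro b c hb hc
    -- Joins reduce to meets and negations by De Morgan.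
    have := hneg _ (hinf _ _ (hneg _ hb) (hneg _ hc))
    rwa [opNeg_inf, opNeg_opNeg, opNeg_opNeg] at this

/-! ### Prime filters and valuations in the 3-element chain -/

variable (A) in
/-- The prime filters of a Kleene algebra. -/
structure IsPrimeFilter (P : Set A) : Prop where
  bot_notMem : ⊥ ∉ P
  top_mem : ⊤ ∈ P
  inf_mem_iff : ∀ a b, a ⊓ b ∈ P ↔ a ∈ P ∧ b ∈ P
  sup_mem_iff : ∀ a b, a ⊔ b ∈ P ↔ a ∈ P ∨ b ∈ P

/-- The prime ideal theorem separates the filter above `a` from the ideal below `b`; the complement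
of the prime ideal is the filter sought. -/
theorem exists_isPrimeFilter {a b : A} (h : ¬ a ≤ b) :
    ∃ P : Set A, IsPrimeFilter A P ∧ a ∈ P ∧ b ∉ P := by
  obtain ⟨J, hJ, hbJ, haJ⟩ := DistribLattice.prime_ideal_of_disjoint_filter_ideal
    (F := Order.PFilter.principal a) (I := Order.Ideal.principal b)
    (Set.disjoint_left.2 fun c hac hcb => h (le_trans hac hcb))
  have ha : a ∉ J := Set.disjoint_left.1 haJ (Order.PFilter.mem_principal.2 le_rfl)
  refine ⟨{c | c ∉ J}, ⟨fun h => h J.bot_mem, fun h => ha (J.lower le_top h), ?_, ?_⟩, ha,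
    fun h => h (hbJ (Order.Ideal.mem_principal.2 le_rfl))⟩
  · intro c d
    simp only [Set.mem_ofPred_eq, ← not_or, not_iff_not]
    exact ⟨hJ.mem_or_mem, fun h => h.elim (J.lower inf_le_left) (J.lower inf_le_right)⟩
  · intro c d
    simp only [Set.mem_ofPred_eq, Order.Ideal.sup_mem_iff]
    tauto

namespace IsPrimeFilter

variable {P : Set A}

theorem dual (hP : IsPrimeFilter A P) : IsPrimeFilter A {a | opNeg a ∉ P} where
  bot_notMem := by simpa [opNeg_bot] using hP.top_mem
  top_mem := by simpa [opNeg_top] using hP.bot_notMem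
  inf_mem_iff a b := by
    simp only [Set.mem_ofPred_eq, opNeg_inf, hP.sup_mem_iff]
    tauto
  sup_mem_iff a b := by
    simp only [Set.mem_ofPred_eq, opNeg_sup, hP.inf_mem_iff]
    tauto

/-- Otherwise some `a ⊓ ¬a` lies in `P` while some `b ⊔ ¬b` does not, against the Kleene identity.
The smaller of `P` and its dual contains no pair `a, ¬a`. -/
theorem subset_dual_or_dual_subset (hP : IsPrimeFilter A P) :
    (∀ a ∈ P, opNeg a ∉ P) ∨ ∀ a, opNeg a ∉ P → a ∈ P := by
  by_contra! h
  obtain ⟨⟨a, ha, ha'⟩, b, hb, hb'⟩ := h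
  have h1 : a ⊓ opNeg a ∈ P := (hP.inf_mem_iff _ _).2 ⟨ha, ha'⟩
  rw [← inf_eq_left.2 (inf_opNeg_le a b), hP.inf_mem_iff, hP.sup_mem_iff] at h1
  tauto

/-- A prime filter that contains no pair `a, ¬ a` gives a homomorphism to the 3-element chain. -/
theorem exists_hom (hP : IsPrimeFilter A P) (h : ∀ a ∈ P, opNeg a ∉ P) :
    ∃ φ : A →[lang] Chain 3, (∀ a, φ a = 2 ↔ a ∈ P) ∧ ∀ a, φ a = 0 ↔ opNeg a ∈ P := by
  classical
  let f : A → Chain 3 := fun a => if a ∈ P then 2 else if opNeg a ∈ P then 0 else 1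
  refine ⟨mkHom f ?_ ?_ ?_ ?_ ?_, ?_, ?_⟩
  · simp only [f, opBot_eq, hP.bot_notMem, opNeg_bot, hP.top_mem, if_true, if_false]
    rfl
  · simp only [f, opTop_eq, hP.top_mem, if_true]
    rfl
  · intro a
    have := h a
    by_cases h1 : a ∈ P <;> by_cases h2 : opNeg a ∈ P <;> simp_all [f] <;> rfl
  · intro a b
    have := h a
    have := h b
    simp only [f, opInf_eq, hP.inf_mem_iff, opNeg_inf, hP.sup_mem_iff]
    by_cases h1 : a ∈ P <;> by_cases h2 : opNeg a ∈ P <;>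
      by_cases h3 : b ∈ P <;> by_cases h4 : opNeg b ∈ P <;> simp_all <;> rfl
  · intro a b
    have := h a
    have := h b
    simp only [f, opSup_eq, hP.sup_mem_iff, opNeg_sup, hP.inf_mem_iff]
    by_cases h1 : a ∈ P <;> by_cases h2 : opNeg a ∈ P <;>
      by_cases h3 : b ∈ P <;> by_cases h4 : opNeg b ∈ P <;> simp_all <;> rfl
  · intro a
    change f a = 2 ↔ _
    by_cases h1 : a ∈ P <;> by_cases h2 : opNeg a ∈ P <;> simp [f, h1, h2]
  · intro a
    have := h a
    change f a = 0 ↔ _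
    by_cases h1 : a ∈ P <;> by_cases h2 : opNeg a ∈ P <;> simp_all [f]

end IsPrimeFilter

theorem exists_hom_ne_zero {a : A} (h : a ≠ ⊥) : ∃ φ : A →[lang] Chain 3, φ a ≠ 0 := by
  obtain ⟨P, hP, ha, -⟩ := exists_isPrimeFilter (mt le_bot_iff.1 h)
  obtain h | h := hP.subset_dual_or_dual_subset
  · obtain ⟨φ, -, hφ⟩ := hP.exists_hom h
    exact ⟨φ, fun h0 => h a ha ((hφ a).1 h0)⟩
  -- Here the dual is the smaller filter, and its valuation vanishes exactly outside `P`.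
  · obtain ⟨φ, -, hφ⟩ := hP.dual.exists_hom fun a ha => by simpa using h a ha
    exact ⟨φ, fun h0 => ((hφ a).1 h0) (by simpa using ha)⟩

/-- A prime filter containing `a` but not `¬a` has `a` in its dual too, so whichever of the two is
smaller sends `a` to the top. -/
theorem exists_hom_eq_two {a : A} (h : ¬ a ≤ opNeg a) : ∃ φ : A →[lang] Chain 3, φ a = 2 := by
  obtain ⟨P, hP, ha, ha'⟩ := exists_isPrimeFilter h
  obtain h | h := hP.subset_dual_or_dual_subset
  · obtain ⟨φ, hφ, -⟩ := hP.exists_hom h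
    exact ⟨φ, (hφ a).2 ha⟩
  · obtain ⟨φ, hφ, -⟩ := hP.dual.exists_hom fun a ha => by simpa using h a ha
    exact ⟨φ, (hφ a).2 ha'⟩

end KleeneLattice

section Classification

attribute [local instance] instDistribLattice instBoundedOrder

/-! ### Modifying valuations of free algebras -/

section FreeAlgebra

variable {Y : Type u}

/-- A valuation in the 3-element chain can be replaced by a two-valued one that preserves the
values `0` and `1`. -/
theorem exists_two_valued (φ : FreeAlg KA Y →[lang] Chain 3) :
    ∃ ψ : FreeAlg KA Y →[lang] Chain 2, ∀ t, (φ t = 2 → ψ t = 1) ∧ (φ t = 0 → ψ t = 0) := by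
  -- The middle value is resolved to `0`; the choice is immaterial, since definite values never
  -- depend on it.
  let ψ : FreeAlg KA Y →[lang] Chain 2 := FreeAlg.lift inVariety_chain_two fun i =>
    if φ (FreeAlg.var KA i) = 2 then 1 else 0
  refine ⟨ψ, freeAlg_induction ?_ ?_ ?_ ?_ ?_ ?_⟩
  · intro i
    have h : ∀ c : Chain 3, (c = 2 → (if c = 2 then 1 else 0 : Chain 2) = 1) ∧
      (c = 0 → (if c = 2 then 1 else 0 : Chain 2) = 0) := by decide
    exact h _
  · rw [map_opBot, map_opBot]
    decide
  · rw [map_opTop, map_opTop]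
    decide
  · intro a
    rw [map_opNeg, map_opNeg]
    generalize φ a = c
    generalize ψ a = p
    revert c p
    decide
  · intro a b
    rw [map_opInf, map_opInf]
    generalize φ a = c, ψ a = p, φ b = d, ψ b = q
    revert c p d q
    decide
  · intro a b
    rw [map_opSup, map_opSup]
    generalize φ a = c, ψ a = p, φ b = d, ψ b = q
    revert c p d q
    decide

/-- The chain with four elements collapses to the chain with three elements. -/
def collapse : Chain 4 →[lang] Chain 3 :=
  mkHom ![0, 1, 1, 2] (by decide) (by decide) (by decide) (by decide) (by decide)

/-- A valuation that is nonzero at `a` lifts through `collapse` because the source is free. -/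
theorem exists_retraction_chain_four {a : FreeAlg KA Y} (ha : a ≤ opNeg a) (ha' : a ≠ ⊥) :
    ∃ j : FreeAlg KA Y →[lang] Chain 4, j a = 1 := by
  obtain ⟨φ, hφ⟩ := exists_hom_ne_zero ha'
  have hc : ∀ c : Chain 3, ∃ d : Chain 4, collapse d = c := by decide
  choose r hr using hc
  let ψ : FreeAlg KA Y →[lang] Chain 4 :=
    FreeAlg.lift inVariety_chain_four fun i => r (φ (FreeAlg.var KA i))
  have hψ : collapse.comp ψ = φ := FreeAlg.hom_ext fun i => hr _
  refine ⟨ψ, ?_⟩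
  have h0 : collapse (ψ a) ≠ 0 := by
    rwa [← hψ] at hφ
  have h1 : opInf (ψ a) (opNeg (ψ a)) = ψ a := by
    rw [← map_opNeg, ← map_opInf, opInf_eq, inf_eq_left.2 ha]
  -- A nonzero collapse excludes `0`, and `d ≤ ¬d` excludes `2` and `3`.
  have h : ∀ d : Chain 4, collapse d ≠ 0 → opInf d (opNeg d) = d → d = 1 := by decide
  exact h _ h0 h1

end FreeAlgebra

/-! ### The free algebra on one generator -/

section OneGenerator

/-- The generator of the free algebra on one generator. -/
def gen : FreeAlg KA Unit := FreeAlg.var KA ()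

/-- The two-valued evaluations of the free algebra on one generator. -/
def ev (p : Chain 2) : FreeAlg KA Unit →[lang] Chain 2 :=
  FreeAlg.lift inVariety_chain_two fun _ => p

theorem closure_gen : Substructure.closure lang {gen} = ⊤ := by
  rw [← FreeAlg.closure_range_var KA Unit, Set.range_unique]
  rfl

/-- Two-valued evaluations do not separate all six elements (`0` and `gen ⊓ ¬gen` agree), but the
truth table of the identity occurs only once. -/
theorem eq_gen {t : FreeAlg KA Unit} (h0 : ev 0 t = 0) (h1 : ev 1 t = 1) : t = gen := by
  have hg (p) : ev p gen = p := rfl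
  have ht : t ∈ Substructure.closure lang {gen} := by rw [closure_gen]; trivial
  obtain rfl | rfl | rfl | rfl | rfl | rfl := mem_closure_singleton ht
  · rw [← opBot_eq, map_opBot] at h1
    exact absurd h1 (by decide)
  · rw [← opTop_eq, map_opTop] at h0
    exact absurd h0 (by decide)
  · rfl
  · rw [map_opNeg, hg] at h0
    exact absurd h0 (by decide)
  · rw [← opInf_eq, map_opInf, map_opNeg, hg] at h1
    exact absurd h1 (by decide)
  · rw [← opSup_eq, map_opSup, map_opNeg, hg] at h0
    exact absurd h0 (by decide)

theorem exists_ev_eq (p q : Chain 2) : ∃ t, ev 0 t = p ∧ ev 1 t = q := by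
  have h : ∀ p q : Chain 2, (p = 0 ∧ q = 0) ∨ (p = 0 ∧ q = 1) ∨ (p = 1 ∧ q = 0) ∨
    (p = 1 ∧ q = 1) := by decide
  obtain ⟨rfl, rfl⟩ | ⟨rfl, rfl⟩ | ⟨rfl, rfl⟩ | ⟨rfl, rfl⟩ := h p q
  · exact ⟨opBot _, map_opBot _, map_opBot _⟩
  · exact ⟨gen, rfl, rfl⟩
  · exact ⟨opNeg gen, map_opNeg _ _, map_opNeg _ _⟩
  · exact ⟨opTop _, map_opTop _, map_opTop _⟩

/-- Incomparability gives two-valued valuations with `a ↦ 1` and `a ↦ 0`. Each variable goes to a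
term whose truth table is its pair of values; then `a` has the truth table of `gen`. -/
theorem exists_retraction_free {Y : Type u} {a : FreeAlg KA Y} (h1 : ¬ a ≤ opNeg a)
    (h0 : ¬ opNeg a ≤ a) : ∃ j : FreeAlg KA Y →[lang] FreeAlg KA Unit, j a = gen := by
  obtain ⟨φ₁, hφ₁⟩ := exists_hom_eq_two h1
  obtain ⟨φ₀, hφ₀⟩ := exists_hom_eq_two (a := opNeg a) (by rwa [opNeg_opNeg])
  obtain ⟨ψ₁, hψ₁⟩ := exists_two_valued φ₁
  obtain ⟨ψ₀, hψ₀⟩ := exists_two_valued φ₀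
  choose m hm₀ hm₁ using exists_ev_eq
  let j : FreeAlg KA Y →[lang] FreeAlg KA Unit :=
    FreeAlg.lift (FreeAlg.inVariety KA Unit) fun i =>
      m (ψ₀ (FreeAlg.var KA i)) (ψ₁ (FreeAlg.var KA i))
  have hj₀ : (ev 0).comp j = ψ₀ := FreeAlg.hom_ext fun i => hm₀ _ _
  have hj₁ : (ev 1).comp j = ψ₁ := FreeAlg.hom_ext fun i => hm₁ _ _
  refine ⟨j, eq_gen ?_ ?_⟩
  · have hc : ∀ c : Chain 3, opNeg c = 2 → c = 0 := by decide
    rw [map_opNeg] at hφ₀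
    exact (DFunLike.congr_fun hj₀ a).trans ((hψ₀ a).2 (hc _ hφ₀))
  · exact (DFunLike.congr_fun hj₁ a).trans ((hψ₁ a).1 hφ₁)

theorem not_gen_le : ¬ gen ≤ opNeg gen := fun h => by
  have := congrArg (ev 1) (inf_eq_left.2 h)
  rw [← opInf_eq, map_opInf, map_opNeg] at this
  exact absurd this (by decide)

theorem not_le_gen : ¬ opNeg gen ≤ gen := fun h => by
  have := congrArg (ev 0) (inf_eq_left.2 h)
  rw [← opInf_eq, map_opInf, map_opNeg] at this
  exact absurd this (by decide)

end OneGenerator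

/-! ### Homomorphisms out of the chains -/

section Chains

variable {A : Type u} [lang.Structure A] [Fact (InVariety KA A)]

/-- A monotone map from a chain that respects the bounds and the negation is a homomorphism. -/
def homOfMonotone {n : ℕ} [NeZero n] (f : Chain n → A) (hf : Monotone f) (hbot : f 0 = ⊥)
    (hneg : ∀ k, f (Fin.rev k) = opNeg (f k)) : Chain n →[lang] A :=
  mkHom f hbot ((hneg 0).trans (hbot ▸ opNeg_bot)) hneg
    hf.map_inf hf.map_sup

variable (A) in
theorem nonempty_hom_chain_two : Nonempty (Chain 2 →[lang] A) :=
  ⟨homOfMonotone ![⊥, ⊤] (Fin.monotone_iff_le_succ.2 fun i => by fin_cases i; exact bot_le) rfl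
    (Fin.forall_fin_two.2 ⟨opNeg_bot.symm, opNeg_top.symm⟩)⟩

theorem exists_hom_chain_four {a : A} (ha : a ≤ opNeg a) :
    ∃ f : Chain 4 →[lang] A, f 1 = a := by
  refine ⟨homOfMonotone ![⊥, a, opNeg a, ⊤] (Fin.monotone_iff_le_succ.2 ?_) rfl ?_, rfl⟩
  · intro i
    fin_cases i
    exacts [bot_le, ha, le_top]
  · intro k
    fin_cases k
    exacts [opNeg_bot.symm, rfl, (opNeg_opNeg a).symm, opNeg_top.symm]

end Chains

theorem hom_chain_two_apply (f : Chain 2 →[lang] Chain 2) : ∀ k, f k = k :=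
  Fin.forall_fin_two.2 ⟨map_opBot f, map_opTop f⟩

theorem hom_chain_four_apply (f : Chain 4 →[lang] Chain 4) (hf : f 1 = 1) (k : Chain 4) :
    f k = k := by
  have h : ∀ k : Chain 4, k = opBot _ ∨ k = 1 ∨ k = opNeg 1 ∨ k = opTop _ := by decide
  obtain rfl | rfl | rfl | rfl := h k
  · exact map_opBot f
  · exact hf
  · rw [map_opNeg, hf]
  · exact map_opTop f

theorem hom_free_apply (f : FreeAlg KA Unit →[lang] FreeAlg KA Unit) (hf : f gen = gen) (t) :
    f t = t :=
  DFunLike.congr_fun (FreeAlg.hom_ext (g := Hom.id lang _) fun _ => hf) t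

theorem closure_chain_two : Substructure.closure lang {(0 : Chain 2)} = ⊤ := by
  rw [eq_top_iff]
  rintro k -
  have h : ∀ k : Chain 2, k = opBot _ ∨ k = opTop _ := by decide
  obtain rfl | rfl := h k
  · exact Substructure.fun_mem _ _ _ nofun
  · exact Substructure.fun_mem _ _ _ nofun

theorem closure_chain_four : Substructure.closure lang {(1 : Chain 4)} = ⊤ := by
  rw [eq_top_iff]
  rintro k -
  have h : ∀ k : Chain 4, k = opBot _ ∨ k = 1 ∨ k = opNeg 1 ∨ k = opTop _ := by decide
  have h1 : (1 : Chain 4) ∈ Substructure.closure lang {(1 : Chain 4)} :=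
    Substructure.subset_closure rfl
  obtain rfl | rfl | rfl | rfl := h k
  · exact Substructure.fun_mem _ _ _ nofun
  · exact h1
  · exact Substructure.fun_mem _ _ _ fun i => by fin_cases i; exact h1
  · exact Substructure.fun_mem _ _ _ nofun

/-! ### Splitting of the three algebras and the classification -/

variable (A : Type u) [lang.Structure A]

/-- Retracts of the free algebra on one generator that are retracts of each free algebra into
which they embed. -/
structure IsSplitting : Prop where
  exists_section : ∃ (s : A →[lang] FreeAlg KA Unit) (r : FreeAlg KA Unit →[lang] A),
    ∀ a, r (s a) = a
  exists_retraction : ∀ (Y : Type v) (i : A →[lang] FreeAlg KA Y), Function.Injective i →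
      ∃ j : FreeAlg KA Y →[lang] A, ∀ a, j (i a) = a

variable {A}

theorem IsSplitting.congr {B : Type w} [lang.Structure B] (h : IsSplitting.{w, v} B)
    (e : A ≃[lang] B) : IsSplitting.{u, v} A where
  exists_section := by
    obtain ⟨s, r, hrs⟩ := h.exists_section
    exact ⟨s.comp e.toHom, e.symm.toHom.comp r, fun a => by
      change e.symm (r (s (e a))) = a
      rw [hrs]
      exact e.toEquiv.symm_apply_apply a⟩
  exists_retraction Y i hi := by
    obtain ⟨j, hj⟩ := h.exists_retraction Y (i.comp e.symm.toHom) (hi.comp e.symm.injective)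
    refine ⟨e.symm.toHom.comp j, fun a => ?_⟩
    have he : e.symm (e a) = a := e.toEquiv.symm_apply_apply a
    have h1 : j (i (e.symm (e a))) = e a := hj (e a)
    rw [he] at h1
    exact (congrArg e.symm h1).trans he

theorem IsSplitting.isStronglyProjective (h : IsSplitting.{u, u} A) :
    IsStronglyProjective KA A := by
  obtain ⟨s, r, hrs⟩ := h.exists_section
  exact IsStronglyProjective.of_retract s r hrs h.exists_retraction

theorem isSplitting_free : IsSplitting.{0, v} (FreeAlg KA Unit) where
  exists_section := ⟨Hom.id lang _, Hom.id lang _, fun _ => rfl⟩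
  exists_retraction Y i hi := by
    have h (a b : FreeAlg KA Unit) (hab : i a ≤ i b) : a ≤ b := by
      rw [← inf_eq_left, ← opInf_eq, ← map_opInf] at hab
      exact inf_eq_left.1 (hi hab)
    obtain ⟨j, hj⟩ := exists_retraction_free (a := i gen)
      (fun h' => not_gen_le (h _ _ (by rwa [map_opNeg])))
      (fun h' => not_le_gen (h _ _ (by rwa [map_opNeg])))
    exact ⟨j, hom_free_apply (j.comp i) hj⟩

theorem isSplitting_chain_four : IsSplitting.{0, v} (Chain 4) where
  exists_section := by
    -- The meet of `gen` and `¬gen` lies below its negation, so it gives a copy of the 4-element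
    -- chain in the free algebra.
    have h : gen ⊓ opNeg gen ≤ opNeg (gen ⊓ opNeg gen) := by
      rw [opNeg_inf, opNeg_opNeg]
      exact inf_le_left.trans le_sup_right
    obtain ⟨s, hs⟩ := exists_hom_chain_four h
    let r : FreeAlg KA Unit →[lang] Chain 4 := FreeAlg.lift inVariety_chain_four fun _ => 1
    refine ⟨s, r, hom_chain_four_apply (r.comp s) ?_⟩
    change r (s 1) = 1
    have hr : r gen = 1 := rfl
    rw [hs, ← opInf_eq, map_opInf, map_opNeg, hr]
    decide
  exists_retraction Y i hi := by
    have h1 : opInf (1 : Chain 4) (opNeg 1) = 1 := by decide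
    obtain ⟨j, hj⟩ := exists_retraction_chain_four (a := i 1)
      (by rw [← inf_eq_left, ← opInf_eq, ← map_opNeg, ← map_opInf, h1])
      (by
        rw [← opBot_eq, ← map_opBot i]
        exact hi.ne (by decide))
    exact ⟨j, hom_chain_four_apply (j.comp i) hj⟩

theorem isSplitting_chain_two : IsSplitting.{0, v} (Chain 2) where
  exists_section := by
    obtain ⟨s⟩ := nonempty_hom_chain_two (FreeAlg KA Unit)
    exact ⟨s, ev 0, hom_chain_two_apply ((ev 0).comp s)⟩
  exists_retraction Y i _ :=
    -- Any valuation works: the 2-element chain has no endomorphism but the identity.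
    let j : FreeAlg KA Y →[lang] Chain 2 := FreeAlg.lift inVariety_chain_two fun _ => 0
    ⟨j, hom_chain_two_apply (j.comp i)⟩

theorem IsSplitting.isOneGenerated_exact (h : IsSplitting.{u, v} A) {a : A}
    (ha : Substructure.closure lang {a} = ⊤) : IsOneGenerated lang A ∧ IsExact KA A := by
  obtain ⟨s, r, hrs⟩ := h.exists_section
  let f : FreeAlg KA Unit →[lang] FreeAlg KA (Fin 1) :=
    FreeAlg.lift (FreeAlg.inVariety _ _) fun _ => FreeAlg.var KA 0
  let g : FreeAlg KA (Fin 1) →[lang] FreeAlg KA Unit :=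
    FreeAlg.lift (FreeAlg.inVariety _ _) fun _ => gen
  exact isOneGenerated_exact_iff.2 ⟨a, ha, 1, f.comp s,
    (Function.LeftInverse.injective (g := g) (hom_free_apply (g.comp f) rfl)).comp
      (Function.LeftInverse.injective hrs)⟩

theorem classification (h : IsOneGenerated lang A ∧ IsExact KA A) :
    Nonempty (A ≃[lang] FreeAlg KA Unit) ∨ Nonempty (A ≃[lang] Chain 4) ∨
      Nonempty (A ≃[lang] Chain 2) := by
  have : Fact (InVariety KA A) := ⟨h.2.1⟩
  obtain ⟨a, ha, n, i, hi⟩ := isOneGenerated_exact_iff.1 h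
  -- Quantified over the generator because it is used for both `a` and `¬a`.
  have four {a : A} (ha : Substructure.closure lang {a} = ⊤) (h1 : i a ≤ opNeg (i a))
      (h2 : i a ≠ ⊥) : Nonempty (A ≃[lang] Chain 4) := by
    have h3 : a ≤ opNeg a := by
      rw [← map_opNeg, ← inf_eq_left, ← opInf_eq, ← map_opInf] at h1
      exact inf_eq_left.1 (hi h1)
    obtain ⟨f, hf⟩ := exists_hom_chain_four h3
    obtain ⟨j, hj⟩ := exists_retraction_chain_four h1 h2
    refine ⟨(equivOfBijective f ⟨?_, surjective_of_closure_singleton ha f ⟨1, hf⟩⟩).symm⟩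
    exact Function.LeftInverse.injective (g := (j.comp i))
      (hom_chain_four_apply ((j.comp i).comp f) ((congrArg (j.comp i) hf).trans hj))
  have two (h1 : i a = ⊥ ∨ i a = ⊤) : Nonempty (A ≃[lang] Chain 2) := by
    obtain ⟨f⟩ := nonempty_hom_chain_two A
    let j : FreeAlg KA (Fin n) →[lang] Chain 2 := FreeAlg.lift inVariety_chain_two fun _ => 0
    refine ⟨(equivOfBijective f ⟨?_, surjective_of_closure_singleton ha f ?_⟩).symm⟩
    · exact Function.LeftInverse.injective (g := (j.comp i)) (hom_chain_two_apply ((j.comp i).comp f))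
    · obtain h1 | h1 := h1
      · exact ⟨opBot _, hi ((congrArg i (map_opBot f)).trans ((map_opBot i).trans h1.symm))⟩
      · exact ⟨opTop _, hi ((congrArg i (map_opTop f)).trans ((map_opTop i).trans h1.symm))⟩
  by_cases h1 : i a ≤ opNeg (i a)
  · right
    by_cases h2 : i a = ⊥
    · exact Or.inr (two (Or.inl h2))
    · exact Or.inl (four ha h1 h2)
  by_cases h0 : opNeg (i a) ≤ i a
  · right
    by_cases h2 : opNeg (i a) = ⊥
    · exact Or.inr (two (Or.inr (by rw [← opNeg_opNeg (i a), h2, opNeg_bot])))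
    · refine Or.inl (four (a := opNeg a) ?_ (by rwa [map_opNeg, opNeg_opNeg])
        (by rwa [map_opNeg]))
      rw [eq_top_iff, ← ha, Substructure.closure_le, Set.singleton_subset_iff]
      rw [← opNeg_opNeg a]
      exact Substructure.fun_mem _ _ _ fun k => by
        fin_cases k
        exact Substructure.subset_closure (by simp)
  · left
    obtain ⟨j, hj⟩ := exists_retraction_free h1 h0
    let f : FreeAlg KA Unit →[lang] A := FreeAlg.lift h.2.1 fun _ => a
    refine ⟨(equivOfBijective f ⟨?_, surjective_of_closure_singleton ha f ⟨gen, rfl⟩⟩).symm⟩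
    exact Function.LeftInverse.injective (g := (j.comp i))
      (hom_free_apply ((j.comp i).comp f) hj)

/-- An isomorphism reflects the order, yet `gen` and `¬gen` are incomparable. -/
theorem isEmpty_free_equiv_chain {n : ℕ} [NeZero n] :
    IsEmpty (FreeAlg KA Unit ≃[lang] Chain n) := by
  refine ⟨fun e => ?_⟩
  have key (a b : FreeAlg KA Unit) (h : e a ≤ e b) : a ≤ b := by
    rw [← inf_eq_left, ← opInf_eq]
    refine e.injective ?_
    exact (map_opInf e.toHom a b).trans (min_eq_left h)
  exact (le_total (e gen) (e (opNeg gen))).elim (fun h => not_gen_le (key _ _ h))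
    fun h => not_le_gen (key _ _ h)

end Classification

end Kleene

theorem theorem5p5 :
    UnivAlg.OneESP.{u} Kleene.KA ∧
    (∀ (A : Type u) [Kleene.lang.Structure A],
      (UnivAlg.IsOneGenerated Kleene.lang A ∧ UnivAlg.IsExact Kleene.KA A) ↔
        (Nonempty (A ≃[Kleene.lang] UnivAlg.FreeAlg Kleene.KA Unit) ∨
          Nonempty (A ≃[Kleene.lang] Kleene.Chain 4) ∨
          Nonempty (A ≃[Kleene.lang] Kleene.Chain 2))) ∧
    (IsEmpty (UnivAlg.FreeAlg Kleene.KA Unit ≃[Kleene.lang] Kleene.Chain 4) ∧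
      IsEmpty (UnivAlg.FreeAlg Kleene.KA Unit ≃[Kleene.lang] Kleene.Chain 2) ∧
      IsEmpty (Kleene.Chain 4 ≃[Kleene.lang] Kleene.Chain 2)) ∧
    UnivAlg.IsStronglyProjective Kleene.KA (UnivAlg.FreeAlg Kleene.KA Unit) ∧
    UnivAlg.IsStronglyProjective Kleene.KA (Kleene.Chain 4) ∧
    UnivAlg.IsStronglyProjective Kleene.KA (Kleene.Chain 2) := by
  refine ⟨fun A _ h1 h2 => ?_, fun A _ => ⟨Kleene.classification, ?_⟩,
    ⟨Kleene.isEmpty_free_equiv_chain, Kleene.isEmpty_free_equiv_chain, ⟨fun e => ?_⟩⟩,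
    Kleene.isSplitting_free.isStronglyProjective,
    Kleene.isSplitting_chain_four.isStronglyProjective,
    Kleene.isSplitting_chain_two.isStronglyProjective⟩
  · obtain ⟨⟨e⟩⟩ | ⟨⟨e⟩⟩ | ⟨⟨e⟩⟩ := Kleene.classification ⟨h1, h2⟩
    · exact (Kleene.isSplitting_free.congr e).isStronglyProjective
    · exact (Kleene.isSplitting_chain_four.congr e).isStronglyProjective
    · exact (Kleene.isSplitting_chain_two.congr e).isStronglyProjective
  · rintro (⟨⟨e⟩⟩ | ⟨⟨e⟩⟩ | ⟨⟨e⟩⟩)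
    · exact UnivAlg.isOneGenerated_exact_congr e
        (Kleene.isSplitting_free.{0}.isOneGenerated_exact Kleene.closure_gen)
    · exact UnivAlg.isOneGenerated_exact_congr e
        (Kleene.isSplitting_chain_four.{0}.isOneGenerated_exact Kleene.closure_chain_four)
    · exact UnivAlg.isOneGenerated_exact_congr e
        (Kleene.isSplitting_chain_two.{0}.isOneGenerated_exact Kleene.closure_chain_two)
  · exact absurd (Fintype.card_congr e.toEquiv) (by decide)
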